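/- Let $U_0=1$, $U_1=13$, $U_2=163$ and $U_{i+3}=12U_{i+2}+6U_{i+1}+12U_i$ for $i\ge 0$, and let $\nu_2$ denote the $2$-adic valuation. There exists a unique $2$-adic integer $\zeta\in\mathbb{Z}_2$ with the property that, if $(i_n)_{n\ge 0}$ is a sequence of non-negative integers such that $\nu_2(U_{i_n})-\frac{i_n}{2}\to\infty$, then $i_n\to\zeta$ in $\mathbb{Z}_2$. Moreover, $\zeta$ is given by the following formula. The polynomial $P(x)=x^3-12x^2-6x-12$ has exactly one root $\beta_1$ in $\mathbb{Z}_2$. Let $\beta_2,\beta_3$, in either order, be its other two roots in $\mathbb{C}_2$ (the completion of an algebraic closure of $\mathbb{Q}_2$), and let \[ c_1=\frac{-U_0\beta_2\beta_3+U_1(\beta_2+\beta_3)-U_2}{(\beta_2-\beta_1)(\beta_1-\beta_3)},\quad c_2=\frac{-U_0\beta_3\beta_1+U_1(\beta_3+\beta_1)-U_2}{(\beta_3-\beta_2)(\beta_2-\beta_1)},\quad c_3=\frac{-U_0\beta_1\beta_2+U_1(\beta_1+\beta_2)-U_2}{(\beta_1-\beta_3)(\beta_3-\beta_2)}, \] so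 that $U_i=c_1\beta_1^i+c_2\beta_2^i+c_3\beta_3^i$ for all $i\ge 0$. Let $\log_2$ denote the $2$-adic logarithm, $\log_2(1+x)=\sum_{n\ge1}(-1)^{n+1}x^n/n$ for $|x|_2<1$. Then $\beta_2$, $\beta_3$, $c_3$ are nonzero, $\left|\left(\tfrac{\beta_3}{\beta_2}\right)^4-1\right|_2<1$, $\left|-\tfrac{c_2\beta_2}{c_3\beta_3}-1\right|_2<1$, $L:=\log_2\left(\left(\tfrac{\beta_3}{\beta_2}\right)^4\right)\neq 0$, and \[ \zeta=1+4\,\frac1L\,\log_2\left(-\frac{c_2\beta_2}{c_3\beta_3}\right). \] -/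

import Mathlib

open Filter Topology Polynomial

noncomputable section

namespace ToySystem

/-- The sequence `U₀ = 1, U₁ = 13, U₂ = 163, Uᵢ₊₃ = 12 Uᵢ₊₂ + 6 Uᵢ₊₁ + 12 Uᵢ`. -/
def U : ℕ → ℕ
  | 0 => 1
  | 1 => 13
  | 2 => 163
  | i + 3 => 12 * U (i + 2) + 6 * U (i + 1) + 12 * U i

/-- All terms are positive, so `padicValNat 2 (U i)` is the usual (finite) 2-adic valuation. -/
theorem U_pos : ∀ i : ℕ, 0 < U i
  | 0 => by simp [U]
  | 1 => by simp [U]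
  | 2 => by simp [U]
  | i + 3 => by
    have := U_pos i
    rw [U]
    omega

/-- The characteristic polynomial `X³ - 12 X² - 6 X - 12` of the recurrence, over a ring `R`. -/
def charPoly (R : Type*) [CommRing R] : R[X] :=
  X ^ 3 - 12 * X ^ 2 - 6 * X - 12

/-- `ζ` is the 2-adic limit of every sequence of indices `i_n` along which
`ν₂(U_{i_n}) - i_n / 2` tends to infinity. -/
def AttractsPeaks (ζ : ℤ_[2]) : Prop :=
  ∀ i : ℕ → ℕ,
    Tendsto (fun n => (padicValNat 2 (U (i n)) : ℝ) - (i n : ℝ) / 2) atTop atTop →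
      Tendsto (fun n => (i n : ℤ_[2])) atTop (𝓝 ζ)

/-- The embedding of the 2-adic integers in the field `ℂ₂`. -/
def emb (x : ℤ_[2]) : ℂ_[2] := algebraMap ℚ_[2] ℂ_[2] (x : ℚ_[2])

/-- The `p`-adic logarithm, given by its power series
`log_p x = ∑_{n ≥ 1} (-1)^(n+1) (x - 1)^n / n`, which converges when `‖x - 1‖ < 1`. -/
def padicLog (p : ℕ) [Fact p.Prime] (x : ℂ_[p]) : ℂ_[p] :=
  ∑' n : ℕ, (-1) ^ n * (x - 1) ^ (n + 1) / ((n : ℂ_[p]) + 1)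

/-- The coefficient of `xⁱ` in the expression of `Uᵢ` as a linear combination of the `i`-th powers
of the three distinct roots `x, y, z` of the characteristic polynomial. -/
def coeff (x y z : ℂ_[2]) : ℂ_[2] :=
  (-(U 0 : ℂ_[2]) * y * z + (U 1 : ℂ_[2]) * (y + z) - (U 2 : ℂ_[2])) / ((y - x) * (x - z))

end ToySystem

end

/-! Write `β₁ = 2 + 2t` with `t ∈ 16ℤ₂`. The other two roots have norm `2^(-1/2)`, larger than `‖β₁‖
= 1/2`, so the `β₁` term of `U i` is negligible and `U (m+1) ≈ c₃β₃β₂^m (r^m - T)`, where `r =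
β₃/β₂` and `T = -c₂β₂/(c₃β₃)` is `target`. Hence `i n` is a peak sequence exactly when `i n → ∞` and
`r^(i n - 1) → T`.

Since `‖T - 1‖ = 1/16` and `‖r^2 - 1‖ = 1/2`, closeness to `T` forces `4 ∣ i - 1`
(`four_dvd_of_norm_lt`). With `q = r^4` and `i = 4k + 1`, the logarithm, 1-Lipschitz near 1, turns
`q^k → T` into `k log q → log T`, which is the formula.

Uniqueness of `ζ` needs a peak sequence to exist. The binary digits of `k` are chosen one by one
(`exists_norm_sub_target_le`): `ℚ₂(β₂)` is ramified, so its residue field is `𝔽₂` and two errors of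
equal norm cancel to leading order, while the distances `‖q^k - T‖` lie in the value group of `ℚ₂`,
so each step gains a full digit. -/

noncomputable section

namespace ToySystem

open scoped IntermediateField

/-! ### The `p`-adic logarithm -/

section PadicLog

variable {p : ℕ} [Fact p.Prime]

theorem norm_natCast_complex (n : ℕ) : ‖(n : ℂ_[p])‖ = ‖(n : ℚ_[p])‖ := by
  rw [← map_natCast (algebraMap ℚ_[p] ℂ_[p]) n, norm_algebraMap']

theorem inv_norm_natCast_le {n : ℕ} (hn : n ≠ 0) : ‖(n : ℂ_[p])‖⁻¹ ≤ n := by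
  have hp : (0 : ℝ) < p := by exact_mod_cast (Fact.out : p.Prime).pos
  rw [norm_natCast_complex, Padic.norm_eq_zpow_neg_valuation (by exact_mod_cast hn),
    Padic.valuation_natCast, zpow_neg, inv_inv, zpow_natCast]
  exact_mod_cast Nat.le_of_dvd (Nat.pos_of_ne_zero hn) pow_padicValNat_dvd

theorem norm_natCast_le_one (n : ℕ) : ‖(n : ℂ_[p])‖ ≤ 1 := by
  rw [norm_natCast_complex]
  exact_mod_cast Padic.norm_int_le_one (p := p) n

theorem norm_div_natCast_succ_le (a x : ℂ_[p]) (n : ℕ) (ha : ‖a‖ ≤ 1) :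
    ‖a * x / ((n : ℂ_[p]) + 1)‖ ≤ (n + 1) * ‖x‖ := by
  have h := inv_norm_natCast_le (p := p) n.succ_ne_zero
  push_cast at h
  rw [norm_div, norm_mul, div_eq_mul_inv, mul_comm]
  exact mul_le_mul h (mul_le_of_le_one_left (norm_nonneg _) ha) (by positivity) (by positivity)

theorem norm_log_term_le (x : ℂ_[p]) (n : ℕ) :
    ‖(-1) ^ n * x ^ (n + 1) / ((n : ℂ_[p]) + 1)‖ ≤ (n + 1) * ‖x‖ ^ (n + 1) := by
  rw [← norm_pow]
  exact norm_div_natCast_succ_le _ _ _ (by simp)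

theorem summable_succ_mul_pow {ρ : ℝ} (h0 : 0 ≤ ρ) (h1 : ρ < 1) :
    Summable fun n : ℕ => ((n : ℝ) + 1) * ρ ^ (n + 1) := by
  have := (summable_nat_add_iff 1).2 (summable_pow_mul_geometric_of_norm_lt_one 1
    (r := ρ) (by rwa [Real.norm_of_nonneg h0]))
  simpa using this

theorem summable_log {x : ℂ_[p]} (hx : ‖x‖ < 1) :
    Summable fun n : ℕ => (-1) ^ n * x ^ (n + 1) / ((n : ℂ_[p]) + 1) :=
  .of_norm_bounded (summable_succ_mul_pow (norm_nonneg x) hx) (norm_log_term_le x)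

theorem tendsto_primePow_zero : Tendsto (fun m : ℕ => (p : ℂ_[p]) ^ m) atTop (𝓝 0) := by
  refine tendsto_pow_atTop_nhds_zero_of_norm_lt_one ?_
  rw [norm_natCast_complex]
  exact Padic.norm_p_lt_one

/-- Since `p^m - 1 → -1`, the limit is the binomial coefficient of `-1`. Pascal's rule gives a
recursion in `j` whose extra term carries a factor `p^m`. -/
theorem tendsto_choose_primePow_pred (j : ℕ) :
    Tendsto (fun m : ℕ => ((p ^ m - 1).choose j : ℂ_[p])) atTop (𝓝 ((-1) ^ j)) := by
  induction j with
  | zero => simp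
  | succ j ih =>
    have key (m : ℕ) : ((p ^ m - 1).choose (j + 1) : ℂ_[p]) =
        (p : ℂ_[p]) ^ m * ((p ^ m - 1).choose j : ℂ_[p]) / ((j : ℂ_[p]) + 1)
          - ((p ^ m - 1).choose j : ℂ_[p]) := by
      obtain ⟨M, hM⟩ : ∃ M, p ^ m = M + 1 :=
        Nat.exists_eq_succ_of_ne_zero (pow_pos (Fact.out : p.Prime).pos m).ne'
      have h1 := congrArg (Nat.cast : ℕ → ℂ_[p]) (Nat.add_one_mul_choose_eq M j)
      have h2 := congrArg (Nat.cast : ℕ → ℂ_[p]) (Nat.choose_succ_succ M j)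
      have h3 : (p : ℂ_[p]) ^ m = (M : ℂ_[p]) + 1 := by exact_mod_cast hM
      have h4 : (j : ℂ_[p]) + 1 ≠ 0 := by exact_mod_cast j.succ_ne_zero
      rw [h3, hM, Nat.add_sub_cancel]
      push_cast at h1 h2
      rw [h1, mul_div_cancel_right₀ _ h4, h2]
      ring
    have := ((tendsto_primePow_zero.mul ih).div_const ((j : ℂ_[p]) + 1)).sub ih
    simp only [zero_mul, zero_div, zero_sub] at this
    rw [pow_succ, mul_neg_one]
    exact this.congr fun m => (key m).symm

theorem hasSum_pow_sub_one_div (x : ℂ_[p]) (m : ℕ) :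
    HasSum (fun j : ℕ => ((p ^ m - 1).choose j : ℂ_[p]) * x ^ (j + 1) / ((j : ℂ_[p]) + 1))
      (((1 + x) ^ p ^ m - 1) / (p : ℂ_[p]) ^ m) := by
  obtain ⟨M, hM⟩ : ∃ M, p ^ m = M + 1 :=
    Nat.exists_eq_succ_of_ne_zero (pow_pos (Fact.out : p.Prime).pos m).ne'
  have h3 : (p : ℂ_[p]) ^ m = (M : ℂ_[p]) + 1 := by exact_mod_cast hM
  have hM0 : (M : ℂ_[p]) + 1 ≠ 0 := by exact_mod_cast M.succ_ne_zero
  rw [h3, hM, Nat.add_sub_cancel]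
  have hs : ((1 + x) ^ (M + 1) - 1) / ((M : ℂ_[p]) + 1) = ∑ j ∈ Finset.range (M + 1),
      (M.choose j : ℂ_[p]) * x ^ (j + 1) / ((j : ℂ_[p]) + 1) := by
    rw [div_eq_iff hM0, add_comm, add_pow, Finset.sum_range_succ', Finset.sum_mul]
    simp only [one_pow, mul_one, pow_zero, Nat.choose_zero_right, Nat.cast_one,
      add_sub_cancel_right]
    refine Finset.sum_congr rfl fun j _ => ?_
    have h4 : (j : ℂ_[p]) + 1 ≠ 0 := by exact_mod_cast j.succ_ne_zero
    have h1 := congrArg (Nat.cast : ℕ → ℂ_[p]) (Nat.add_one_mul_choose_eq M j)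
    push_cast at h1
    field_simp
    rw [mul_comm (x ^ (j + 1)), mul_assoc, mul_comm (x ^ (j + 1)), ← mul_assoc]
    linear_combination (-x ^ (j + 1)) * h1
  rw [hs]
  refine hasSum_sum_of_ne_finset_zero fun j hj => ?_
  rw [Nat.choose_eq_zero_of_lt (by simpa using hj)]
  simp

/-- Dominated convergence applied to the binomial expansion. This description of the logarithm
yields its power law without manipulating series. -/
theorem tendsto_padicLog {y : ℂ_[p]} (hy : ‖y - 1‖ < 1) :
    Tendsto (fun m : ℕ => (y ^ p ^ m - 1) / (p : ℂ_[p]) ^ m) atTop (𝓝 (padicLog p y)) := by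
  have h := tendsto_tsum_of_dominated_convergence
    (f := fun (m j : ℕ) =>
      ((p ^ m - 1).choose j : ℂ_[p]) * (y - 1) ^ (j + 1) / ((j : ℂ_[p]) + 1))
    (g := fun j : ℕ => (-1) ^ j * (y - 1) ^ (j + 1) / ((j : ℂ_[p]) + 1)) (𝓕 := atTop)
    (summable_succ_mul_pow (norm_nonneg (y - 1)) hy)
    (fun j => ((tendsto_choose_primePow_pred j).mul_const _).div_const _)
    (.of_forall fun m j => by
      rw [← norm_pow]
      exact norm_div_natCast_succ_le _ _ _ (norm_natCast_le_one _))
  refine h.congr fun m => ?_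
  rw [(hasSum_pow_sub_one_div (y - 1) m).tsum_eq, add_sub_cancel]

theorem norm_pow_sub_one_le {y : ℂ_[p]} (hy : ‖y - 1‖ < 1) (k : ℕ) :
    ‖y ^ k - 1‖ ≤ ‖y - 1‖ := by
  have hy1 : ‖y‖ ≤ 1 := by
    calc ‖y‖ = ‖(y - 1) + 1‖ := by ring_nf
      _ ≤ max ‖y - 1‖ ‖(1 : ℂ_[p])‖ := IsUltrametricDist.norm_add_le_max _ _
      _ ≤ 1 := by simp [hy.le]
  induction k with
  | zero => simp
  | succ k ih =>
    calc ‖y ^ (k + 1) - 1‖ = ‖y * (y ^ k - 1) + (y - 1)‖ := by ring_nf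
      _ ≤ max ‖y * (y ^ k - 1)‖ ‖y - 1‖ := IsUltrametricDist.norm_add_le_max _ _
      _ ≤ ‖y - 1‖ := by
        rw [norm_mul]
        exact max_le ((mul_le_of_le_one_left (norm_nonneg _) hy1).trans ih) le_rfl

theorem padicLog_pow {y : ℂ_[p]} (hy : ‖y - 1‖ < 1) (k : ℕ) :
    padicLog p (y ^ k) = k * padicLog p y := by
  have hl := tendsto_padicLog hy
  have hp0 : (p : ℂ_[p]) ≠ 0 := by exact_mod_cast (Fact.out : p.Prime).ne_zero
  have hz : Tendsto (fun m : ℕ => y ^ p ^ m) atTop (𝓝 1) := by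
    have h := (tendsto_primePow_zero.mul hl).add_const 1
    simp only [zero_mul, zero_add] at h
    refine h.congr fun m => ?_
    rw [mul_div_cancel₀ _ (pow_ne_zero m hp0), sub_add_cancel]
  have hg : Tendsto (fun m : ℕ => ∑ j ∈ Finset.range k, (y ^ p ^ m) ^ j) atTop
      (𝓝 (k : ℂ_[p])) := by
    have h := tendsto_finsetSum (Finset.range k) fun j _ => hz.pow j
    simpa using h
  refine tendsto_nhds_unique
    (tendsto_padicLog ((norm_pow_sub_one_le hy k).trans_lt hy)) ?_
  -- `y^(k p^m) - 1` is `y^(p^m) - 1` times a geometric sum of `k` terms, each tending to 1.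
  refine (hg.mul hl).congr fun m => ?_
  rw [← mul_div_assoc, geom_sum_mul, pow_right_comm]

theorem norm_tsum_le_of_forall_le {f : ℕ → ℂ_[p]} {C : ℝ} (h : ∀ i, ‖f i‖ ≤ C) :
    ‖∑' i, f i‖ ≤ C :=
  IsUltrametricDist.norm_tsum_le_of_forall_le h

theorem norm_pow_succ_sub_pow_succ_le {a b : ℂ_[p]} {ρ : ℝ} (ha : ‖a‖ ≤ ρ) (hb : ‖b‖ ≤ ρ)
    (n : ℕ) : ‖a ^ (n + 1) - b ^ (n + 1)‖ ≤ ρ ^ n * ‖a - b‖ := by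
  have hρ : 0 ≤ ρ := (norm_nonneg a).trans ha
  induction n with
  | zero => simp
  | succ n ih =>
    calc ‖a ^ (n + 2) - b ^ (n + 2)‖
        = ‖a ^ (n + 1) * (a - b) + b * (a ^ (n + 1) - b ^ (n + 1))‖ := by ring_nf
      _ ≤ max ‖a ^ (n + 1) * (a - b)‖ ‖b * (a ^ (n + 1) - b ^ (n + 1))‖ :=
        IsUltrametricDist.norm_add_le_max _ _
      _ ≤ ρ ^ (n + 1) * ‖a - b‖ := by
        rw [norm_mul, norm_mul, norm_pow]
        refine max_le (by gcongr) ?_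
        calc ‖b‖ * ‖a ^ (n + 1) - b ^ (n + 1)‖ ≤ ρ * (ρ ^ n * ‖a - b‖) := by gcongr
          _ = ρ ^ (n + 1) * ‖a - b‖ := by ring

theorem succ_mul_quarter_pow_le_one (n : ℕ) : ((n : ℝ) + 1) * (1 / 4) ^ n ≤ 1 := by
  induction n with
  | zero => simp
  | succ n ih =>
    have : (0 : ℝ) ≤ (1 / 4) ^ n := by positivity
    have hn : (0 : ℝ) ≤ n := n.cast_nonneg
    push_cast
    rw [pow_succ]
    nlinarith [mul_nonneg hn this]

/-- On this ball the factor `(1/4)^n` from the difference of powers absorbs the denominator, as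
`1/‖n+1‖ ≤ n+1`. -/
theorem norm_padicLog_sub_le {x y : ℂ_[p]} (hx : ‖x - 1‖ ≤ 1 / 4) (hy : ‖y - 1‖ ≤ 1 / 4) :
    ‖padicLog p x - padicLog p y‖ ≤ ‖x - y‖ := by
  rw [padicLog, padicLog, ← (summable_log (hx.trans_lt (by norm_num))).tsum_sub
    (summable_log (hy.trans_lt (by norm_num)))]
  refine norm_tsum_le_of_forall_le fun n => ?_
  rw [← sub_div, ← mul_sub]
  refine (norm_div_natCast_succ_le _ _ n (by simp)).trans ?_
  have h := norm_pow_succ_sub_pow_succ_le hx hy n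
  rw [sub_sub_sub_cancel_right] at h
  calc ((n : ℝ) + 1) * ‖(x - 1) ^ (n + 1) - (y - 1) ^ (n + 1)‖
      ≤ ((n : ℝ) + 1) * ((1 / 4) ^ n * ‖x - y‖) := by gcongr
    _ = (((n : ℝ) + 1) * (1 / 4) ^ n) * ‖x - y‖ := by ring
    _ ≤ ‖x - y‖ := mul_le_of_le_one_left (norm_nonneg _) (succ_mul_quarter_pow_le_one n)

/-- The linear term `y - 1` dominates: every later term has at most half its norm. -/
theorem padicLog_ne_zero {y : ℂ_[p]} (hy : ‖y - 1‖ ≤ 1 / 8) (hy1 : y ≠ 1) :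
    padicLog p y ≠ 0 := by
  intro h0
  have hlt : ‖y - 1‖ < 1 := hy.trans_lt (by norm_num)
  have hpos : 0 < ‖y - 1‖ := norm_pos_iff.2 (sub_ne_zero.2 hy1)
  have hs := (summable_log hlt).tsum_eq_zero_add
  rw [padicLog] at h0
  rw [h0] at hs
  have hb : ‖∑' n : ℕ, (-1) ^ (n + 1) * (y - 1) ^ (n + 1 + 1) / (((n + 1 : ℕ) : ℂ_[p]) + 1)‖ ≤
      ‖y - 1‖ / 2 := by
    refine norm_tsum_le_of_forall_le fun n => (norm_log_term_le _ _).trans ?_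
    have hn := succ_mul_quarter_pow_le_one (n + 1)
    have h2 : ‖y - 1‖ ^ (n + 1) ≤ (1 / 4) ^ (n + 1) * (1 / 2) := by
      calc ‖y - 1‖ ^ (n + 1) ≤ (1 / 8) ^ (n + 1) := by gcongr
        _ = (1 / 4) ^ (n + 1) * (1 / 2) ^ (n + 1) := by rw [← mul_pow]; norm_num
        _ ≤ (1 / 4) ^ (n + 1) * (1 / 2) := by
          gcongr
          exact pow_le_of_le_one (by norm_num) (by norm_num) n.succ_ne_zero
    calc (((n + 1 : ℕ) : ℝ) + 1) * ‖y - 1‖ ^ (n + 1 + 1)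
        = (((n + 1 : ℕ) : ℝ) + 1) * ‖y - 1‖ ^ (n + 1) * ‖y - 1‖ := by ring
      _ ≤ (((n + 1 : ℕ) : ℝ) + 1) * ((1 / 4) ^ (n + 1) * (1 / 2)) * ‖y - 1‖ := by gcongr
      _ = ((((n + 1 : ℕ) : ℝ) + 1) * (1 / 4) ^ (n + 1)) * (‖y - 1‖ / 2) := by ring
      _ ≤ ‖y - 1‖ / 2 := mul_le_of_le_one_left (by positivity) hn
  have hneg : y - 1 = -∑' n : ℕ,
      (-1) ^ (n + 1) * (y - 1) ^ (n + 1 + 1) / (((n + 1 : ℕ) : ℂ_[p]) + 1) := by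
    simpa [add_eq_zero_iff_eq_neg] using hs.symm
  rw [← norm_neg, ← hneg] at hb
  linarith

end PadicLog

/-! ### Ultrametric norm computations -/

theorem norm_eq_of_norm_sub_lt {x y : ℂ_[2]} (h : ‖x - y‖ < ‖y‖) : ‖x‖ = ‖y‖ := by
  have := IsUltrametricDist.norm_add_eq_max_of_norm_ne_norm h.ne
  rwa [sub_add_cancel, max_eq_right h.le] at this

theorem norm_sub_eq_left {x y : ℂ_[2]} (h : ‖y‖ < ‖x‖) : ‖x - y‖ = ‖x‖ :=
  norm_eq_of_norm_sub_lt (by rwa [sub_sub_cancel_left, norm_neg])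

theorem norm_natCast_of_odd {n : ℕ} (hn : Odd n) : ‖(n : ℂ_[2])‖ = 1 := by
  rw [norm_natCast_complex, Padic.norm_natCast_eq_one_iff]
  exact hn.coprime_two_left

theorem norm_two : ‖(2 : ℂ_[2])‖ = 1 / 2 := by
  have := norm_natCast_complex (p := 2) 2
  rw [Padic.norm_p] at this
  simpa using this

theorem norm_add_le_of_le {x y : ℂ_[2]} {ρ : ℝ} (hx : ‖x‖ ≤ ρ) (hy : ‖y‖ ≤ ρ) : ‖x + y‖ ≤ ρ :=
  (IsUltrametricDist.norm_add_le_max x y).trans (max_le hx hy)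

/-- Read off the norm of a polynomial expression in an integral `u`, `2 ^ k` times a unit. -/
theorem norm_eq_of_eq_two_pow_mul {u x : ℂ_[2]} (hu : ‖u‖ ≤ 1) (k n : ℕ) (a b c d : ℤ)
    (hn : Odd n)
    (hx : x = 2 ^ k * ((n : ℂ_[2]) + 2 * (a + b * u + c * u ^ 2 + d * u ^ 3))) :
    ‖x‖ = (1 / 2) ^ k := by
  have hterm (m : ℤ) (i : ℕ) : ‖(m : ℂ_[2]) * u ^ i‖ ≤ 1 := by
    rw [norm_mul, norm_pow]
    refine mul_le_one₀ ?_ (by positivity) (pow_le_one₀ (norm_nonneg _) hu)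
    rw [← map_intCast (algebraMap ℚ_[2] ℂ_[2]), norm_algebraMap']
    exact Padic.norm_int_le_one _
  have hw : ‖(a : ℂ_[2]) + b * u + c * u ^ 2 + d * u ^ 3‖ ≤ 1 :=
    norm_add_le_of_le (norm_add_le_of_le (norm_add_le_of_le (by simpa using hterm a 0)
      (by simpa using hterm b 1)) (hterm c 2)) (hterm d 3)
  have h : ‖(n : ℂ_[2]) + 2 * (a + b * u + c * u ^ 2 + d * u ^ 3)‖ = ‖(n : ℂ_[2])‖ := by
    refine norm_eq_of_norm_sub_lt ?_
    rw [add_sub_cancel_left, norm_mul, norm_two, norm_natCast_of_odd hn]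
    linarith
  rw [hx, norm_mul, norm_pow, norm_two, h, norm_natCast_of_odd hn, mul_one]

/-! ### Norms of the roots, the coefficients and the target -/

theorem coeff_third_eq (t b₂ b₃ : ℂ_[2]) : coeff b₃ (2 + 2 * t) b₂ =
    (-(2 + 2 * t) * b₂ + 13 * ((2 + 2 * t) + b₂) - 163) /
      (((2 + 2 * t) - b₃) * (b₃ - b₂)) := by
  simp [coeff, U]

theorem coeff_first_eq (t b₂ b₃ : ℂ_[2]) : coeff (2 + 2 * t) b₂ b₃ =
    (-(b₂ * b₃) + 13 * (b₂ + b₃) - 163) /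
      ((2 + 2 * t) * (b₂ + b₃) - (2 + 2 * t) ^ 2 - b₂ * b₃) := by
  simp only [coeff, U]
  congr 1
  · push_cast
    ring
  · ring

/-- The limit, along a peak sequence `i`, of `(b₃ / b₂) ^ (i - 1)`. -/
def target (t b₂ b₃ : ℂ_[2]) : ℂ_[2] :=
  -(coeff b₂ b₃ (2 + 2 * t) * b₂) / (coeff b₃ (2 + 2 * t) b₂ * b₃)

/-- `2 + 2 t`, `b₂`, `b₃` are the roots of the characteristic polynomial, where `t ∈ 16 ℤ₂`. -/
structure IsRootTriple (t b₂ b₃ : ℂ_[2]) : Prop where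
  norm_t : ‖t‖ ≤ 1 / 16
  mem_range : t ∈ Set.range (algebraMap ℚ_[2] ℂ_[2])
  sum : b₂ + b₃ = 10 - 2 * t
  prod : b₂ * b₃ = -26 - 16 * t + 4 * t ^ 2
  rel : 2 * t ^ 3 - 6 * t ^ 2 - 21 * t - 16 = 0

namespace IsRootTriple

variable {t b₂ b₃ : ℂ_[2]} (h : IsRootTriple t b₂ b₃)
include h

theorem symm : IsRootTriple t b₃ b₂ :=
  ⟨h.norm_t, h.mem_range, by rw [add_comm, h.sum], by rw [mul_comm, h.prod], h.rel⟩

theorem exists_eq_mul : ∃ u : ℂ_[2], ‖u‖ ≤ 1 ∧ t = 16 * u := by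
  refine ⟨t / 16, ?_, by field_simp⟩
  have : ‖(16 : ℂ_[2])‖ = 1 / 16 := by
    rw [show (16 : ℂ_[2]) = 2 ^ 4 by norm_num, norm_pow, norm_two]; norm_num
  rw [norm_div, this, div_le_one (by norm_num)]
  exact h.norm_t

theorem norm_root_mul_root : ‖b₂‖ * ‖b₃‖ = 1 / 2 := by
  obtain ⟨u, hu, rfl⟩ := h.exists_eq_mul
  rw [← norm_mul, norm_eq_of_eq_two_pow_mul hu 1 1 (-7) (-64) 256 0 (by decide),
    pow_one]
  rw [h.prod]
  push_cast
  ring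

theorem norm_sum_eq : ‖b₂ + b₃‖ = 1 / 2 := by
  obtain ⟨u, hu, rfl⟩ := h.exists_eq_mul
  rw [norm_eq_of_eq_two_pow_mul hu 1 5 0 (-8) 0 0 (by decide), pow_one]
  rw [h.sum]
  push_cast
  ring

/-- Unequal norms would both be at most that of the sum, `1/2`, making the product too small. -/
theorem norm_eq : ‖b₃‖ = ‖b₂‖ := by
  by_contra hne
  have h1 := h.norm_root_mul_root
  have h2 := h.norm_sum_eq
  rw [IsUltrametricDist.norm_add_eq_max_of_norm_ne_norm (Ne.symm hne)] at h2
  have h3 := le_max_left ‖b₂‖ ‖b₃‖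
  have h4 := le_max_right ‖b₂‖ ‖b₃‖
  rw [h2] at h3 h4
  nlinarith [norm_nonneg b₂, norm_nonneg b₃]

theorem norm_mul_self_eq : ‖b₂‖ * ‖b₂‖ = 1 / 2 := by
  have := h.norm_root_mul_root
  rwa [h.norm_eq] at this

theorem norm_lt_one : ‖b₂‖ < 1 := by nlinarith [h.norm_mul_self_eq, norm_nonneg b₂]

theorem half_lt_norm : 1 / 2 < ‖b₂‖ := by nlinarith [h.norm_mul_self_eq, norm_nonneg b₂]

theorem ne_zero : b₂ ≠ 0 := norm_pos_iff.1 (by linarith [h.half_lt_norm])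

theorem norm_first_root : ‖2 + 2 * t‖ = 1 / 2 := by
  obtain ⟨u, hu, rfl⟩ := h.exists_eq_mul
  rw [norm_eq_of_eq_two_pow_mul hu 1 1 0 8 0 0 (by decide), pow_one]
  push_cast
  ring

theorem norm_sub_first_root : ‖b₂ - (2 + 2 * t)‖ = ‖b₂‖ :=
  norm_sub_eq_left (by rw [h.norm_first_root]; exact h.half_lt_norm)

theorem norm_sub : ‖b₃ - b₂‖ = 1 / 2 := by
  have h1 : ‖(b₃ - b₂) ^ 2‖ = (1 / 2) ^ 2 := by
    obtain ⟨u, hu, rfl⟩ := h.exists_eq_mul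
    -- The discriminant is `204 + 24t - 12t²`, and `204 = 4 · 51`.
    refine norm_eq_of_eq_two_pow_mul hu 2 51 0 48 (-384) 0 (by decide) ?_
    have : (b₃ - b₂) ^ 2 = (b₂ + b₃) ^ 2 - 4 * (b₂ * b₃) := by ring
    rw [this, h.sum, h.prod]
    push_cast
    ring
  rw [norm_pow] at h1
  exact (pow_left_inj₀ (norm_nonneg _) (by norm_num) two_ne_zero).1 h1

theorem norm_ratio : ‖b₃ / b₂‖ = 1 := by
  rw [norm_div, h.norm_eq, div_self (norm_ne_zero_iff.2 h.ne_zero)]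

theorem norm_ratio_sq_sub_one : ‖(b₃ / b₂) ^ 2 - 1‖ = 1 / 2 := by
  have h0 := h.ne_zero
  have : (b₃ / b₂) ^ 2 - 1 = (b₃ - b₂) * (b₂ + b₃) / (b₂ * b₂) := by
    field_simp
    ring
  rw [this, norm_div, norm_mul, norm_mul, h.norm_sub, h.norm_sum_eq, h.norm_mul_self_eq]
  norm_num

theorem norm_ratio_sq_add_one : ‖(b₃ / b₂) ^ 2 + 1‖ = 1 / 4 := by
  have h0 := h.ne_zero
  have h1 : ‖b₂ ^ 2 + b₃ ^ 2‖ = (1 / 2) ^ 3 := by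
    obtain ⟨u, hu, rfl⟩ := h.exists_eq_mul
    refine norm_eq_of_eq_two_pow_mul hu 3 19 0 (-8) (-64) 0 (by decide) ?_
    have : b₂ ^ 2 + b₃ ^ 2 = (b₂ + b₃) ^ 2 - 2 * (b₂ * b₃) := by ring
    rw [this, h.sum, h.prod]
    push_cast
    ring
  have : (b₃ / b₂) ^ 2 + 1 = (b₂ ^ 2 + b₃ ^ 2) / (b₂ * b₂) := by
    field_simp
    ring
  rw [this, norm_div, norm_mul, h1, h.norm_mul_self_eq]
  norm_num

theorem norm_ratio_pow_four_sub_one : ‖(b₃ / b₂) ^ 4 - 1‖ = 1 / 8 := by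
  have : (b₃ / b₂) ^ 4 - 1 = ((b₃ / b₂) ^ 2 - 1) * ((b₃ / b₂) ^ 2 + 1) := by ring
  rw [this, norm_mul, h.norm_ratio_sq_sub_one, h.norm_ratio_sq_add_one]
  norm_num

/-- The numerator of the third coefficient is a unit. -/
theorem norm_numerator :
    ‖-(2 + 2 * t) * b₂ + 13 * ((2 + 2 * t) + b₂) - 163‖ = 1 := by
  have h13 : ‖(13 : ℂ_[2])‖ = 1 := by
    simpa using norm_natCast_of_odd (n := 13) (by decide)
  have h163 : ‖(-163 : ℂ_[2])‖ = 1 := by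
    simpa using norm_natCast_of_odd (n := 163) (by decide)
  rw [← h163]
  refine norm_eq_of_norm_sub_lt ?_
  rw [h163, show -(2 + 2 * t) * b₂ + 13 * ((2 + 2 * t) + b₂) - 163 - -163 =
    -(2 + 2 * t) * b₂ + (13 * (2 + 2 * t) + 13 * b₂) by ring]
  have h2 := h.norm_first_root
  have h3 := h.half_lt_norm
  have h4 := h.norm_lt_one
  refine (norm_add_le_of_le (ρ := ‖b₂‖) ?_ (norm_add_le_of_le ?_ ?_)).trans_lt h4
  · rw [norm_mul, norm_neg, h2]
    linarith
  · rw [norm_mul, h2, h13]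
    linarith
  · rw [norm_mul, h13, one_mul]

theorem norm_coeff_third_mul : ‖coeff b₃ (2 + 2 * t) b₂ * b₃‖ = 2 := by
  have h0 : ‖b₃‖ ≠ 0 := norm_ne_zero_iff.2 h.symm.ne_zero
  rw [coeff_third_eq, norm_mul, norm_div, h.norm_numerator, norm_mul, norm_sub_rev _ b₃,
    h.symm.norm_sub_first_root, h.norm_sub]
  field_simp

theorem coeff_third_ne_zero : coeff b₃ (2 + 2 * t) b₂ ≠ 0 := by
  intro h0
  have := h.norm_coeff_third_mul
  rw [h0] at this
  simp at this

theorem norm_coeff_first : ‖coeff (2 + 2 * t) b₂ b₃‖ = 2 := by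
  have h1 : ‖-(b₂ * b₃) + 13 * (b₂ + b₃) - 163‖ = (1 / 2) ^ 0 := by
    obtain ⟨u, hu, rfl⟩ := h.exists_eq_mul
    refine norm_eq_of_eq_two_pow_mul hu 0 1 (-4) (-80) (-512) 0 (by decide) ?_
    rw [h.sum, h.prod]
    push_cast
    ring
  have h2 : (2 + 2 * t) * (b₂ + b₃) - (2 + 2 * t) ^ 2 - b₂ * b₃ =
      (b₂ - (2 + 2 * t)) * ((2 + 2 * t) - b₃) := by ring
  rw [coeff_first_eq, norm_div, h1, h2, norm_mul, norm_sub_rev _ b₃, h.norm_sub_first_root,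
    h.symm.norm_sub_first_root, h.norm_root_mul_root]
  norm_num

theorem roots_sub_ne_zero : b₃ - b₂ ≠ 0 := by
  rw [← norm_ne_zero_iff, h.norm_sub]
  norm_num

theorem sub_first_root_ne_zero : b₂ - (2 + 2 * t) ≠ 0 := by
  rw [← norm_ne_zero_iff, h.norm_sub_first_root]
  exact norm_ne_zero_iff.2 h.ne_zero

theorem target_sub_one_eq :
    target t b₂ b₃ - 1 =
      (b₃ - b₂) * (-560 - 346 * t + 128 * t ^ 2 - 8 * t ^ 3) /
        ((-(2 + 2 * t) * b₂ + 13 * ((2 + 2 * t) + b₂) - 163) * (b₂ - (2 + 2 * t)) * b₃) := by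
  have hN : -(2 + 2 * t) * b₂ + 13 * ((2 + 2 * t) + b₂) - 163 ≠ 0 := by
    rw [← norm_ne_zero_iff, h.norm_numerator]
    norm_num
  have h1 := h.roots_sub_ne_zero
  have h2 := h.sub_first_root_ne_zero
  have h3 : (2 + 2 * t) - b₃ ≠ 0 := by
    rw [← neg_sub]
    exact neg_ne_zero.2 h.symm.sub_first_root_ne_zero
  have h4 := h.symm.ne_zero
  have hc2 : coeff b₂ b₃ (2 + 2 * t) =
      (-b₃ * (2 + 2 * t) + 13 * (b₃ + (2 + 2 * t)) - 163) /
        ((b₃ - b₂) * (b₂ - (2 + 2 * t))) := by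
    simp [coeff, U]
  -- The numerator of `T - 1` vanishes at `b₂ = b₃`; its cofactor is symmetric, hence a polynomial
  -- in `t`.
  have hnum : (b₂ * b₃) * (13 - (2 + 2 * t)) + (2 + 2 * t) * (13 * (2 + 2 * t) - 163) =
      -560 - 346 * t + 128 * t ^ 2 - 8 * t ^ 3 := by
    rw [h.prod]
    ring
  rw [target, coeff_third_eq, hc2, ← hnum]
  generalize hM : -(2 + 2 * t) * b₂ + 13 * ((2 + 2 * t) + b₂) - 163 = M at *
  generalize 2 + 2 * t = B at *
  field_simp
  rw [← hM]
  ring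

theorem norm_target_sub_one :
    ‖target t b₂ b₃ - 1‖ = 1 / 16 := by
  have h1 : ‖-560 - 346 * t + 128 * t ^ 2 - 8 * t ^ 3‖ = (1 / 2) ^ 4 := by
    obtain ⟨u, hu, rfl⟩ := h.exists_eq_mul
    refine norm_eq_of_eq_two_pow_mul hu 4 1
      (-18) (-173) 1024 (-1024) (by decide) ?_
    push_cast
    ring
  rw [h.target_sub_one_eq, norm_div, norm_mul, norm_mul, norm_mul, h.norm_numerator, h.norm_sub,
    h.norm_sub_first_root, h1, one_mul, h.norm_root_mul_root]
  norm_num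

theorem coeff_sum_eq (i : ℕ) : (U i : ℂ_[2]) =
    coeff (2 + 2 * t) b₂ b₃ * (2 + 2 * t) ^ i + coeff b₂ b₃ (2 + 2 * t) * b₂ ^ i
      + coeff b₃ (2 + 2 * t) b₂ * b₃ ^ i := by
  have h1 := h.roots_sub_ne_zero
  have h2 := h.sub_first_root_ne_zero
  have h3 : (2 + 2 * t) - b₃ ≠ 0 := by
    rw [← neg_sub]
    exact neg_ne_zero.2 h.symm.sub_first_root_ne_zero
  have e1 : (2 + 2 * t) ^ 3 = 12 * (2 + 2 * t) ^ 2 + 6 * (2 + 2 * t) + 12 := by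
    linear_combination 4 * h.rel
  have e2 : b₂ ^ 3 = 12 * b₂ ^ 2 + 6 * b₂ + 12 := by
    linear_combination (b₂ ^ 2 - (2 + 2 * t) * b₂) * h.sum - (b₂ - (2 + 2 * t)) * h.prod
      + 4 * h.rel
  have e3 : b₃ ^ 3 = 12 * b₃ ^ 2 + 6 * b₃ + 12 := by
    linear_combination (b₃ ^ 2 - (2 + 2 * t) * b₃) * h.sum - (b₃ - (2 + 2 * t)) * h.prod
      + 4 * h.rel
  induction i using Nat.strong_induction_on with
  | _ i ih =>
    match i, ih with
    | 0, _ =>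
      simp only [coeff, U]
      push_cast
      generalize 2 + 2 * t = B at *
      field_simp
      ring
    | 1, _ =>
      simp only [coeff, U]
      push_cast
      generalize 2 + 2 * t = B at *
      field_simp
      ring
    | 2, _ =>
      simp only [coeff, U]
      push_cast
      generalize 2 + 2 * t = B at *
      field_simp
      ring
    | i + 3, ih =>
      rw [U]
      push_cast
      rw [ih (i + 2) (by lia), ih (i + 1) (by lia), ih i (by lia)]
      linear_combination (-coeff (2 + 2 * t) b₂ b₃ * (2 + 2 * t) ^ i) * e1
        - coeff b₂ b₃ (2 + 2 * t) * b₂ ^ i * e2 - coeff b₃ (2 + 2 * t) b₂ * b₃ ^ i * e3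

end IsRootTriple
-- Peaks and approximation of the target by powers of `β₃/β₂`
theorem norm_U (i : ℕ) :
    ‖(U i : ℂ_[2])‖ = Real.exp (-((padicValNat 2 (U i) : ℝ) * Real.log 2)) := by
  rw [norm_natCast_complex,
    Padic.norm_eq_zpow_neg_valuation (by exact_mod_cast (U_pos i).ne'), Padic.valuation_natCast,
    zpow_neg, zpow_natCast, Real.exp_neg, mul_comm, Real.exp_mul, Real.exp_log (by norm_num),
    Real.rpow_natCast]
  norm_num

/-- Indices below `N` have bounded valuations, hence cannot recur along a peak sequence. -/
theorem tendsto_index_of_peaks {i : ℕ → ℕ}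
    (hi : Tendsto (fun n => (padicValNat 2 (U (i n)) : ℝ) - (i n : ℝ) / 2) atTop atTop) :
    Tendsto i atTop atTop := by
  refine tendsto_atTop.2 fun N => ?_
  filter_upwards [hi.eventually_gt_atTop (∑ j ∈ Finset.range N, (padicValNat 2 (U j) : ℝ))]
    with n hn
  by_contra! hlt
  have h1 : (padicValNat 2 (U (i n)) : ℝ) ≤ ∑ j ∈ Finset.range N, (padicValNat 2 (U j) : ℝ) :=
    Finset.single_le_sum (f := fun j => (padicValNat 2 (U j) : ℝ)) (fun _ _ => by positivity)
      (Finset.mem_range.2 hlt)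
  have h2 : (0 : ℝ) ≤ i n := by positivity
  linarith

namespace IsRootTriple

variable {t b₂ b₃ : ℂ_[2]} (h : IsRootTriple t b₂ b₃)
include h

theorem norm_eq_exp : ‖b₂‖ = Real.exp (-(Real.log 2 / 2)) := by
  have h1 : ‖b₂‖ ^ 2 = Real.exp (-(Real.log 2 / 2)) ^ 2 := by
    rw [sq, h.norm_mul_self_eq, ← Real.exp_nat_mul]
    push_cast
    rw [show (2 : ℝ) * -(Real.log 2 / 2) = -Real.log 2 by ring, Real.exp_neg,
      Real.exp_log (by norm_num)]
    norm_num
  exact (pow_left_inj₀ (norm_nonneg _) (Real.exp_pos _).le two_ne_zero).1 h1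

/-- The quotient on the right is `2^(-(ν - i/2))`. -/
theorem tendsto_peaks_iff (i : ℕ → ℕ) :
    Tendsto (fun n => (padicValNat 2 (U (i n)) : ℝ) - (i n : ℝ) / 2) atTop atTop ↔
      Tendsto (fun n => ‖(U (i n) : ℂ_[2])‖ / ‖b₂‖ ^ i n) atTop (𝓝 0) := by
  have key (n : ℕ) : ‖(U (i n) : ℂ_[2])‖ / ‖b₂‖ ^ i n =
      Real.exp (-(((padicValNat 2 (U (i n)) : ℝ) - (i n : ℝ) / 2) * Real.log 2)) := by
    rw [norm_U, h.norm_eq_exp, ← Real.exp_nat_mul, ← Real.exp_sub]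
    congr 1
    ring
  simp only [key]
  rw [Real.tendsto_exp_comp_nhds_zero, tendsto_neg_atBot_iff,
    tendsto_mul_const_atTop_of_pos (Real.log_pos one_lt_two)]

theorem coeff_third_mul_eq (m : ℕ) :
    (U (m + 1) : ℂ_[2]) - coeff (2 + 2 * t) b₂ b₃ * (2 + 2 * t) ^ (m + 1) =
      coeff b₃ (2 + 2 * t) b₂ * b₃ * b₂ ^ m * ((b₃ / b₂) ^ m - target t b₂ b₃) := by
  have h2 := h.ne_zero
  have h3 := h.symm.ne_zero
  have hc := h.coeff_third_ne_zero
  rw [h.coeff_sum_eq, target, div_pow]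
  generalize coeff b₃ (2 + 2 * t) b₂ = c at *
  field_simp
  ring

theorem norm_coeff_third_mul_eq (m : ℕ) :
    ‖(U (m + 1) : ℂ_[2]) - coeff (2 + 2 * t) b₂ b₃ * (2 + 2 * t) ^ (m + 1)‖ =
      2 * ‖b₂‖ ^ m * ‖(b₃ / b₂) ^ m - target t b₂ b₃‖ := by
  rw [h.coeff_third_mul_eq, norm_mul, norm_mul, h.norm_coeff_third_mul, norm_pow]

theorem norm_first_term (m : ℕ) :
    ‖coeff (2 + 2 * t) b₂ b₃ * (2 + 2 * t) ^ m‖ = 2 * (‖b₂‖ ^ m * ‖b₂‖ ^ m) := by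
  rw [norm_mul, norm_pow, h.norm_coeff_first, h.norm_first_root, ← mul_pow, h.norm_mul_self_eq]

theorem norm_pow_sub_target_le (m : ℕ) :
    ‖(b₃ / b₂) ^ m - target t b₂ b₃‖ ≤
      ‖(U (m + 1) : ℂ_[2])‖ / ‖b₂‖ ^ (m + 1) + ‖b₂‖ ^ (m + 1) := by
  have hpos : 0 < ‖b₂‖ ^ (m + 1) := pow_pos (by linarith [h.half_lt_norm]) _
  have h1 := norm_sub_le (U (m + 1) : ℂ_[2]) (coeff (2 + 2 * t) b₂ b₃ * (2 + 2 * t) ^ (m + 1))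
  rw [h.norm_coeff_third_mul_eq, h.norm_first_term] at h1
  have h2 : ‖b₂‖ ^ (m + 1) ≤ ‖b₂‖ ^ m :=
    pow_le_pow_of_le_one (norm_nonneg _) h.norm_lt_one.le m.le_succ
  rw [← mul_le_mul_iff_of_pos_right hpos, add_mul, div_mul_cancel₀ _ hpos.ne']
  have h3 := mul_le_mul_of_nonneg_right h2 (norm_nonneg ((b₃ / b₂) ^ m - target t b₂ b₃))
  nlinarith [norm_nonneg (U (m + 1) : ℂ_[2]), mul_pos hpos hpos]

theorem norm_U_div_le (m : ℕ) :
    ‖(U (m + 1) : ℂ_[2])‖ / ‖b₂‖ ^ (m + 1) ≤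
      4 * ‖(b₃ / b₂) ^ m - target t b₂ b₃‖ + 2 * ‖b₂‖ ^ (m + 1) := by
  have hpos : 0 < ‖b₂‖ ^ (m + 1) := pow_pos (by linarith [h.half_lt_norm]) _
  have h1 := norm_le_norm_sub_add (U (m + 1) : ℂ_[2])
    (coeff (2 + 2 * t) b₂ b₃ * (2 + 2 * t) ^ (m + 1))
  rw [h.norm_coeff_third_mul_eq, h.norm_first_term] at h1
  have h2 : ‖b₂‖ ^ m ≤ 2 * ‖b₂‖ ^ (m + 1) := by
    rw [pow_succ]
    nlinarith [h.half_lt_norm, pow_pos (show 0 < ‖b₂‖ by linarith [h.half_lt_norm]) m]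
  have h3 := mul_le_mul_of_nonneg_right h2 (norm_nonneg ((b₃ / b₂) ^ m - target t b₂ b₃))
  rw [div_le_iff₀ hpos]
  linarith

theorem norm_ratio_pow_four_pow_sub_one_le (k : ℕ) : ‖((b₃ / b₂) ^ 4) ^ k - 1‖ ≤ 1 / 8 := by
  rw [← h.norm_ratio_pow_four_sub_one]
  exact norm_pow_sub_one_le (by rw [h.norm_ratio_pow_four_sub_one]; norm_num) k

theorem log_ratio_ne_zero : padicLog 2 ((b₃ / b₂) ^ 4) ≠ 0 := by
  have h1 := h.norm_ratio_pow_four_sub_one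
  refine padicLog_ne_zero h1.le fun h0 => ?_
  rw [h0] at h1
  norm_num at h1

/-- If `m ≡ 2 mod 4`, then `r^m` is within `1/8` of `r^2`, which is at distance exactly `1/2` from
1. Odd `m` reduces to this case by doubling. -/
theorem four_dvd_of_norm_lt {m : ℕ} (hm : ‖(b₃ / b₂) ^ m - 1‖ < 1 / 2) : 4 ∣ m := by
  have htwo {m : ℕ} (hm : ‖(b₃ / b₂) ^ m - 1‖ < 1 / 2) : m % 4 ≠ 2 := by
    intro h2
    obtain ⟨k, rfl⟩ : ∃ k, m = 4 * k + 2 := ⟨m / 4, by lia⟩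
    have e : (b₃ / b₂) ^ 2 - 1 =
        ((b₃ / b₂) ^ (4 * k + 2) - 1) - (b₃ / b₂) ^ 2 * (((b₃ / b₂) ^ 4) ^ k - 1) := by
      rw [pow_add, pow_mul]
      ring
    have h3 := IsUltrametricDist.norm_add_le_max ((b₃ / b₂) ^ (4 * k + 2) - 1)
      (-((b₃ / b₂) ^ 2 * (((b₃ / b₂) ^ 4) ^ k - 1)))
    rw [norm_neg, ← sub_eq_add_neg, ← e, h.norm_ratio_sq_sub_one, norm_mul, norm_pow, h.norm_ratio, one_pow, one_mul] at h3
    have h4 := h.norm_ratio_pow_four_pow_sub_one_le k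
    have h5 := max_lt hm (h4.trans_lt (by norm_num : (1 : ℝ) / 8 < 1 / 2))
    linarith
  have hdouble : ‖(b₃ / b₂) ^ (2 * m) - 1‖ < 1 / 2 := by
    have e : (b₃ / b₂) ^ (2 * m) - 1 = ((b₃ / b₂) ^ m - 1) * ((b₃ / b₂) ^ m + 1) := by
      rw [pow_mul']
      ring
    rw [e, norm_mul]
    refine (mul_le_of_le_one_right (norm_nonneg _) ?_).trans_lt hm
    exact norm_add_le_of_le (by rw [norm_pow, h.norm_ratio, one_pow]) (by rw [norm_one])
  have h1 := htwo hm
  have h2 := htwo hdouble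
  lia

theorem norm_index_sub_le {k : ℕ} {ε : ℝ}
    (hk : ‖((b₃ / b₂) ^ 4) ^ k - target t b₂ b₃‖ ≤ ε) :
    ‖((4 * k + 1 : ℕ) : ℂ_[2]) - (1 + 4 * (1 / padicLog 2 ((b₃ / b₂) ^ 4)) *
      padicLog 2 (target t b₂ b₃))‖ ≤ ‖4 / padicLog 2 ((b₃ / b₂) ^ 4)‖ * ε := by
  have hL := h.log_ratio_ne_zero
  have h1 := norm_padicLog_sub_le
    ((h.norm_ratio_pow_four_pow_sub_one_le k).trans (by norm_num))
    (h.norm_target_sub_one.le.trans (by norm_num))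
  rw [padicLog_pow (by rw [h.norm_ratio_pow_four_sub_one]; norm_num)] at h1
  have e : ((4 * k + 1 : ℕ) : ℂ_[2]) - (1 + 4 * (1 / padicLog 2 ((b₃ / b₂) ^ 4)) *
      padicLog 2 (target t b₂ b₃)) = 4 / padicLog 2 ((b₃ / b₂) ^ 4) *
        (k * padicLog 2 ((b₃ / b₂) ^ 4) - padicLog 2 (target t b₂ b₃)) := by
    push_cast
    generalize padicLog 2 ((b₃ / b₂) ^ 4) = L at *
    field_simp
    ring
  rw [e, norm_mul]
  exact mul_le_mul_of_nonneg_left (h1.trans hk) (norm_nonneg _)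

theorem tendsto_index {i : ℕ → ℕ}
    (hi : Tendsto (fun n => (padicValNat 2 (U (i n)) : ℝ) - (i n : ℝ) / 2) atTop atTop) :
    Tendsto (fun n => (i n : ℂ_[2])) atTop (𝓝 (1 + 4 * (1 / padicLog 2 ((b₃ / b₂) ^ 4)) *
      padicLog 2 (target t b₂ b₃))) := by
  have hinf := tendsto_index_of_peaks hi
  have hε : Tendsto (fun n => ‖(U (i n) : ℂ_[2])‖ / ‖b₂‖ ^ i n + ‖b₂‖ ^ i n) atTop (𝓝 0) := by
    simpa using ((h.tendsto_peaks_iff i).1 hi).add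
      ((tendsto_pow_atTop_nhds_zero_of_lt_one (norm_nonneg _) h.norm_lt_one).comp hinf)
  rw [tendsto_iff_norm_sub_tendsto_zero]
  have hlim := hε.const_mul ‖4 / padicLog 2 ((b₃ / b₂) ^ 4)‖
  rw [mul_zero] at hlim
  refine squeeze_zero' (.of_forall fun _ => norm_nonneg _) ?_ hlim
  filter_upwards [hinf.eventually_ge_atTop 1, hε.eventually_lt_const (by norm_num : (0 : ℝ) < 1 / 2)]
    with n hn hlt
  obtain ⟨m, hm⟩ := Nat.exists_eq_succ_of_ne_zero (Nat.one_le_iff_ne_zero.1 hn)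
  rw [hm] at hlt ⊢
  have hle := h.norm_pow_sub_target_le m
  -- `r^m` is within `1/2` of the target, which is within `1/16` of 1.
  obtain ⟨k, rfl⟩ : 4 ∣ m := h.four_dvd_of_norm_lt <| by
    rw [← sub_add_sub_cancel _ (target t b₂ b₃) 1]
    refine (IsUltrametricDist.norm_add_le_max _ _).trans_lt (max_lt (hle.trans_lt hlt) ?_)
    rw [h.norm_target_sub_one]
    norm_num
  exact h.norm_index_sub_le (by rwa [← pow_mul])

end IsRootTriple
-- Existence of peak sequences
theorem norm_sub_one_lt_of_norm_eq_one {x : ℚ_[2]} (hx : ‖x‖ = 1) : ‖x - 1‖ < 1 := by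
  obtain ⟨z, rfl⟩ : ∃ z : ℤ_[2], (z : ℚ_[2]) = x := ⟨⟨x, hx.le⟩, rfl⟩
  have h1 := PadicInt.norm_sub_zmodRepr_lt_one z
  have h2 := PadicInt.zmodRepr_lt_p z
  have h3 : z.zmodRepr ≠ 0 := by
    intro h0
    rw [h0, Nat.cast_zero, sub_zero] at h1
    exact h1.ne hx
  rw [show z.zmodRepr = 1 by lia, PadicInt.norm_def] at h1
  simpa using h1

namespace IsRootTriple

variable {t b₂ b₃ : ℂ_[2]} (h : IsRootTriple t b₂ b₃)
include h

theorem mem_fieldRange : t ∈ (algebraMap ℚ_[2] ℂ_[2]).fieldRange := h.mem_range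

theorem sum_mem_fieldRange : b₂ + b₃ ∈ (algebraMap ℚ_[2] ℂ_[2]).fieldRange := by
  rw [h.sum]
  exact sub_mem (ofNat_mem _ _) (mul_mem (ofNat_mem _ _) h.mem_fieldRange)

theorem prod_mem_fieldRange : b₂ * b₃ ∈ (algebraMap ℚ_[2] ℂ_[2]).fieldRange := by
  rw [h.prod]
  exact add_mem (sub_mem (neg_mem (ofNat_mem _ _)) (mul_mem (ofNat_mem _ _) h.mem_fieldRange))
    (mul_mem (ofNat_mem _ _) (pow_mem h.mem_fieldRange _))

theorem exists_eq_add_mul {z : ℂ_[2]} (hz : z ∈ ℚ_[2]⟮b₂⟯) :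
    ∃ x y : ℚ_[2], z = algebraMap ℚ_[2] ℂ_[2] x + algebraMap ℚ_[2] ℂ_[2] y * b₂ := by
  obtain ⟨a, ha⟩ := h.sum_mem_fieldRange
  obtain ⟨b, hb⟩ := h.prod_mem_fieldRange
  let f : ℚ_[2][X] := X ^ 2 - C a * X + C b
  have hf : f.Monic := by
    simp only [f]
    monicity!
  have hroot : aeval b₂ f = 0 := by
    simp [f, ha, hb]
    ring
  have hint : IsIntegral ℚ_[2] b₂ := ⟨f, hf, hroot⟩
  rw [← IntermediateField.mem_toSubalgebra,
    IntermediateField.adjoin_simple_toSubalgebra_of_isAlgebraic hint.isAlgebraic,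
    Algebra.adjoin_singleton_eq_range_aeval] at hz
  obtain ⟨g, rfl⟩ := hz
  have hdeg : f.natDegree = 2 := by
    simp only [f]
    compute_degree!
  have hlt : (g %ₘ f).natDegree < 2 := by
    refine lt_of_lt_of_eq ?_ hdeg
    exact natDegree_modByMonic_lt g hf (by intro h1; rw [h1] at hdeg; simp at hdeg)
  refine ⟨(g %ₘ f).coeff 0, (g %ₘ f).coeff 1, ?_⟩
  have e : aeval b₂ g = aeval b₂ (g %ₘ f) := by
    conv_lhs => rw [← modByMonic_add_div g f]
    simp [hroot]
  change aeval b₂ g = _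
  rw [e, aeval_eq_sum_range' hlt]
  simp [Finset.sum_range_succ, Algebra.smul_def]

/-- `b₂` generates a ramified extension of `ℚ₂`, so the residue field stays `𝔽₂`. -/
theorem norm_sub_one_lt {z : ℂ_[2]} (hz : z ∈ ℚ_[2]⟮b₂⟯) (h1 : ‖z‖ = 1) : ‖z - 1‖ < 1 := by
  obtain ⟨x, y, rfl⟩ := h.exists_eq_add_mul hz
  have hsq : ‖algebraMap ℚ_[2] ℂ_[2] y * b₂‖ ^ 2 = ‖y‖ ^ 2 / 2 := by
    rw [norm_mul, norm_algebraMap', mul_pow, sq ‖b₂‖, h.norm_mul_self_eq]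
    ring
  -- Nonzero `x` and `y b₂` have valuations in `ℤ` and `ℤ + 1/2`.
  have hne : ‖algebraMap ℚ_[2] ℂ_[2] x‖ ≠ ‖algebraMap ℚ_[2] ℂ_[2] y * b₂‖ := by
    intro he
    rw [← he, norm_algebraMap'] at hsq
    by_cases hx : x = 0
    · subst hx
      have hy : y = 0 := by simpa using hsq.symm
      simp [hy] at h1
    have hy : y ≠ 0 := by
      rintro rfl
      simp [hx] at hsq
    rw [Padic.norm_eq_zpow_neg_valuation hx, Padic.norm_eq_zpow_neg_valuation hy,
      ← zpow_natCast, ← zpow_natCast, ← zpow_mul, ← zpow_mul, div_eq_mul_inv] at hsq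
    have h2 : ((2 : ℕ) : ℝ) ≠ 0 := by norm_num
    have h3 : (2 : ℝ)⁻¹ = ((2 : ℕ) : ℝ) ^ (-1 : ℤ) := by norm_num
    rw [h3, ← zpow_add₀ h2] at hsq
    have := zpow_right_injective₀ (by norm_num) (by norm_num) hsq
    push_cast at this
    lia
  have hmax := IsUltrametricDist.norm_add_eq_max_of_norm_ne_norm hne
  rw [h1] at hmax
  have hyb : ‖algebraMap ℚ_[2] ℂ_[2] y * b₂‖ ≤ 1 := by
    rw [hmax]
    exact le_max_right _ _
  have hy1 : ‖y‖ ≤ 1 := by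
    have h2 : ‖y‖ < (2 : ℕ) ^ ((0 : ℤ) + 1) := by
      have : ‖y‖ ^ 2 ≤ 2 := by nlinarith [norm_nonneg (algebraMap ℚ_[2] ℂ_[2] y * b₂)]
      have : ‖y‖ < 2 := by nlinarith [norm_nonneg y]
      simpa using this
    simpa using (Padic.norm_le_pow_iff_norm_lt_pow_add_one y 0).2 h2
  have hyb' : ‖algebraMap ℚ_[2] ℂ_[2] y * b₂‖ < 1 := by
    rw [norm_mul, norm_algebraMap']
    nlinarith [h.norm_lt_one, norm_nonneg y, norm_nonneg b₂]
  have hx : ‖x‖ = 1 := by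
    rw [norm_algebraMap'] at hmax
    rcases max_choice ‖x‖ ‖algebraMap ℚ_[2] ℂ_[2] y * b₂‖ with hc | hc
    · rw [hmax, hc]
    · linarith
  rw [show algebraMap ℚ_[2] ℂ_[2] x + algebraMap ℚ_[2] ℂ_[2] y * b₂ - 1 =
    algebraMap ℚ_[2] ℂ_[2] (x - 1) + algebraMap ℚ_[2] ℂ_[2] y * b₂ by simp; ring]
  refine (IsUltrametricDist.norm_add_le_max _ _).trans_lt (max_lt ?_ hyb')
  rw [norm_algebraMap']
  exact norm_sub_one_lt_of_norm_eq_one hx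

theorem t_mem_adjoin : t ∈ ℚ_[2]⟮b₂⟯ := by
  obtain ⟨τ, rfl⟩ := h.mem_range
  exact algebraMap_mem _ τ

theorem other_mem_adjoin : b₃ ∈ ℚ_[2]⟮b₂⟯ := by
  rw [show b₃ = 10 - 2 * t - b₂ by rw [← h.sum]; ring]
  exact sub_mem (sub_mem (ofNat_mem _ _) (mul_mem (ofNat_mem _ _) h.t_mem_adjoin)) (IntermediateField.mem_adjoin_simple_self ℚ_[2] b₂)

theorem target_mem_adjoin : target t b₂ b₃ ∈ ℚ_[2]⟮b₂⟯ := by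
  have hB : 2 + 2 * t ∈ ℚ_[2]⟮b₂⟯ :=
    add_mem (ofNat_mem _ _) (mul_mem (ofNat_mem _ _) h.t_mem_adjoin)
  have hc {x y z : ℂ_[2]} (hx : x ∈ ℚ_[2]⟮b₂⟯) (hy : y ∈ ℚ_[2]⟮b₂⟯) (hz : z ∈ ℚ_[2]⟮b₂⟯) :
      coeff x y z ∈ ℚ_[2]⟮b₂⟯ :=
    div_mem (sub_mem (add_mem (mul_mem (mul_mem (neg_mem (natCast_mem _ _)) hy) hz)
      (mul_mem (natCast_mem _ _) (add_mem hy hz))) (natCast_mem _ _))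
      (mul_mem (sub_mem hy hx) (sub_mem hx hz))
  have h2 := (IntermediateField.mem_adjoin_simple_self ℚ_[2] b₂)
  have h3 := h.other_mem_adjoin
  exact div_mem (neg_mem (mul_mem (hc h2 h3 hB) h2)) (mul_mem (hc h3 hB h2) h3)

/-- The distances from the powers of `(b₃ / b₂) ^ 4` to the target are norms of elements of `ℚ₂`. -/
theorem exists_norm_eq (k : ℕ) : ∃ x : ℚ_[2],
    ‖((b₃ / b₂) ^ 4) ^ k - target t b₂ b₃‖ = ‖x‖ := by
  have hB : 2 + 2 * t ∈ (algebraMap ℚ_[2] ℂ_[2]).fieldRange :=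
    add_mem (ofNat_mem _ _) (mul_mem (ofNat_mem _ _) h.mem_fieldRange)
  have hc : coeff (2 + 2 * t) b₂ b₃ ∈ (algebraMap ℚ_[2] ℂ_[2]).fieldRange := by
    have hs := h.sum_mem_fieldRange
    have hp := h.prod_mem_fieldRange
    rw [coeff_first_eq]
    exact div_mem (sub_mem (add_mem (neg_mem hp) (mul_mem (ofNat_mem _ _) hs)) (ofNat_mem _ _))
      (sub_mem (sub_mem (mul_mem hB hs) (pow_mem hB _)) hp)
  -- `c₁` is symmetric in `b₂, b₃`, so this lies in `ℚ₂`. The factor `2 / 4^k` cancels the norms of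
  -- `c₃b₃` and `b₂^(4k)`.
  obtain ⟨x, hx⟩ : ((U (4 * k + 1) : ℂ_[2]) -
      coeff (2 + 2 * t) b₂ b₃ * (2 + 2 * t) ^ (4 * k + 1)) * 2 / 4 ^ k ∈
        (algebraMap ℚ_[2] ℂ_[2]).fieldRange :=
    div_mem (mul_mem (sub_mem (natCast_mem _ _) (mul_mem hc (pow_mem hB _))) (ofNat_mem _ _))
      (pow_mem (ofNat_mem _ _) _)
  refine ⟨x, ?_⟩
  have hb4 : ‖b₂‖ ^ (4 * k) = (1 / 4) ^ k := by
    rw [pow_mul, show ‖b₂‖ ^ 4 = (‖b₂‖ * ‖b₂‖) ^ 2 by ring, h.norm_mul_self_eq]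
    norm_num
  have h4 : ‖(4 : ℂ_[2])‖ = 1 / 4 := by
    rw [show (4 : ℂ_[2]) = 2 ^ 2 by norm_num, norm_pow, norm_two]
    norm_num
  rw [← norm_algebraMap' ℂ_[2] x, hx, norm_div, norm_mul, h.norm_coeff_third_mul_eq, hb4,
    norm_pow, norm_two, h4, pow_mul]
  field_simp

/-- The norms of `ℚ₂` are integral powers of 2, so any improvement gains a whole digit, not the half
digit that ramification would allow. -/
theorem norm_sub_target_succ {k n : ℕ} 
    (hk : ‖((b₃ / b₂) ^ 4) ^ k - target t b₂ b₃‖ < (1 / 2) ^ n) :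
    ‖((b₃ / b₂) ^ 4) ^ k - target t b₂ b₃‖ ≤ (1 / 2) ^ (n + 1) := by
  obtain ⟨x, hx⟩ := h.exists_norm_eq k
  rw [hx] at hk ⊢
  have e (m : ℕ) : ((2 : ℕ) : ℝ) ^ (-(m : ℤ)) = (1 / 2) ^ m := by
    simp
  rw [← e] at hk ⊢
  rw [Padic.norm_lt_pow_iff_norm_le_pow_sub_one] at hk
  push_cast at hk ⊢
  rwa [neg_add']

theorem norm_pow_two_pow_sub_one (n : ℕ) :
    ‖((b₃ / b₂) ^ 4) ^ 2 ^ n - 1‖ = (1 / 2) ^ (n + 3) := by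
  induction n with
  | zero =>
    rw [pow_zero, pow_one, h.norm_ratio_pow_four_sub_one]
    norm_num
  | succ n ih =>
    set w := ((b₃ / b₂) ^ 4) ^ 2 ^ n with hw
    have h2 : ‖w + 1‖ = 1 / 2 := by
      rw [← norm_two]
      refine norm_eq_of_norm_sub_lt ?_
      rw [show w + 1 - 2 = w - 1 by ring, ih, norm_two, pow_add]
      have : ((1 : ℝ) / 2) ^ n ≤ 1 := pow_le_one₀ (by norm_num) (by norm_num)
      linarith
    rw [show ((b₃ / b₂) ^ 4) ^ 2 ^ (n + 1) - 1 = (w - 1) * (w + 1) by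
      rw [pow_succ 2 n, pow_mul, ← hw]; ring, norm_mul, ih, h2]
    ring

/-- If the error `q^k - T` has norm exactly `2^(-(n+3))`, adding `2^n` to `k` changes `q^k` by an
element of the same norm. The quotient `z` of the two is a unit congruent to 1, so the new error
carries the factor `z + 1 = (z - 1) + 2`, of norm less than 1. -/
theorem exists_norm_sub_target_le (n : ℕ) :
    ∃ k, ‖((b₃ / b₂) ^ 4) ^ k - target t b₂ b₃‖ ≤ (1 / 2) ^ (n + 3) := by
  induction n with
  | zero =>
    refine ⟨0, ?_⟩
    rw [pow_zero, norm_sub_rev, h.norm_target_sub_one]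
    norm_num
  | succ n ih =>
    obtain ⟨k, hk⟩ := ih
    rcases hk.lt_or_eq with hlt | heq
    · exact ⟨k, h.norm_sub_target_succ hlt⟩
    refine ⟨k + 2 ^ n, h.norm_sub_target_succ ?_⟩
    set q := (b₃ / b₂) ^ 4 with hq
    have hD := h.norm_pow_two_pow_sub_one n
    have hpos : (0 : ℝ) < (1 / 2) ^ (n + 3) := by positivity
    have hqn : ‖q ^ k‖ = 1 := by rw [norm_pow, hq, norm_pow, h.norm_ratio]; simp
    have hqm : q ∈ ℚ_[2]⟮b₂⟯ := pow_mem (div_mem h.other_mem_adjoin (IntermediateField.mem_adjoin_simple_self ℚ_[2] b₂)) 4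
    have hden : ‖q ^ k * (q ^ 2 ^ n - 1)‖ = (1 / 2) ^ (n + 3) := by
      rw [norm_mul, hqn, hD, one_mul]
    have hden0 : q ^ k * (q ^ 2 ^ n - 1) ≠ 0 := by
      rw [← norm_ne_zero_iff, hden]
      exact hpos.ne'
    have hz := h.norm_sub_one_lt (z := (q ^ k - target t b₂ b₃) / (q ^ k * (q ^ 2 ^ n - 1)))
      (div_mem (sub_mem (pow_mem hqm _) h.target_mem_adjoin)
        (mul_mem (pow_mem hqm _) (sub_mem (pow_mem hqm _) (one_mem _))))
      (by rw [norm_div, heq, hden, div_self hpos.ne'])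
    have e : q ^ (k + 2 ^ n) - target t b₂ b₃ = q ^ k * (q ^ 2 ^ n - 1) *
        (((q ^ k - target t b₂ b₃) / (q ^ k * (q ^ 2 ^ n - 1)) - 1) + 2) := by
      rw [mul_add, mul_sub, mul_div_cancel₀ _ hden0]
      ring
    rw [e, norm_mul, hden]
    refine mul_lt_of_lt_one_right hpos ((IsUltrametricDist.norm_add_le_max _ _).trans_lt ?_)
    exact max_lt hz (by rw [norm_two]; norm_num)

/-- Adding `2^n` to `k` makes it large at a cost of `2^(-(n+3))`; large exponents are needed to make
the `β₁` term negligible. -/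
theorem exists_ge_norm_sub_target_le (n : ℕ) :
    ∃ k ≥ n, ‖((b₃ / b₂) ^ 4) ^ k - target t b₂ b₃‖ ≤ (1 / 2) ^ n := by
  obtain ⟨k, hk⟩ := h.exists_norm_sub_target_le n
  have hle : ((1 : ℝ) / 2) ^ (n + 3) ≤ (1 / 2) ^ n :=
    pow_le_pow_of_le_one (by norm_num) (by norm_num) (by lia)
  refine ⟨k + 2 ^ n, (Nat.lt_two_pow_self.le.trans (Nat.le_add_left _ _)), ?_⟩
  rw [show ((b₃ / b₂) ^ 4) ^ (k + 2 ^ n) - target t b₂ b₃ =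
    ((b₃ / b₂) ^ 4) ^ k * (((b₃ / b₂) ^ 4) ^ 2 ^ n - 1) +
      (((b₃ / b₂) ^ 4) ^ k - target t b₂ b₃) by ring]
  refine norm_add_le_of_le ?_ (hk.trans hle)
  rw [norm_mul, h.norm_pow_two_pow_sub_one, norm_pow, norm_pow, h.norm_ratio]
  simpa using hle

theorem exists_peaks : ∃ i : ℕ → ℕ,
    Tendsto (fun n => (padicValNat 2 (U (i n)) : ℝ) - (i n : ℝ) / 2) atTop atTop := by
  choose k hkn hk using h.exists_ge_norm_sub_target_le
  refine ⟨fun n => 4 * k n + 1, (h.tendsto_peaks_iff _).2 ?_⟩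
  have hinf : Tendsto (fun n => 4 * k n + 1) atTop atTop :=
    tendsto_atTop_mono (fun n => by have := hkn n; simp only [id]; lia) tendsto_id
  have h1 : Tendsto (fun n : ℕ => 4 * ((1 : ℝ) / 2) ^ n + 2 * ‖b₂‖ ^ (4 * k n + 1)) atTop
      (𝓝 0) := by
    have ha := (tendsto_pow_atTop_nhds_zero_of_lt_one (r := (1 : ℝ) / 2) (by norm_num)
      (by norm_num)).const_mul 4
    have hb := ((tendsto_pow_atTop_nhds_zero_of_lt_one (norm_nonneg b₂) h.norm_lt_one).comp
      hinf).const_mul 2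
    simpa using ha.add hb
  refine squeeze_zero (fun n => by positivity) (fun n => ?_) h1
  refine (h.norm_U_div_le (4 * k n)).trans ?_
  rw [pow_mul]
  gcongr
  exact hk n

end IsRootTriple
-- The root in `ℤ₂` and the limit `ζ`
/-- `emb` as a ring homomorphism. -/
def embHom : ℤ_[2] →+* ℂ_[2] := (algebraMap ℚ_[2] ℂ_[2]).comp PadicInt.Coe.ringHom

theorem embHom_apply (x : ℤ_[2]) : embHom x = emb x := rfl

theorem norm_emb (x : ℤ_[2]) : ‖emb x‖ = ‖x‖ := by
  rw [emb, norm_algebraMap', PadicInt.norm_def]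

theorem emb_natCast (n : ℕ) : emb n = n := map_natCast embHom n

theorem isometry_emb : Isometry emb :=
  AddMonoidHomClass.isometry_of_norm embHom norm_emb

theorem charPoly_isRoot_iff {R : Type*} [CommRing R] (x : R) :
    (charPoly R).IsRoot x ↔ x ^ 3 - 12 * x ^ 2 - 6 * x - 12 = 0 := by
  simp [charPoly]

theorem two_dvd_of_isRoot {x : ℤ_[2]} (hx : (charPoly ℤ_[2]).IsRoot x) : 2 ∣ x := by
  rw [charPoly_isRoot_iff] at hx
  have hp : Prime (2 : ℤ_[2]) := by simpa using PadicInt.prime_p (p := 2)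
  exact hp.dvd_of_dvd_pow (n := 3) ⟨6 * x ^ 2 + 3 * x + 6, by linear_combination hx⟩

theorem not_isUnit_two : ¬IsUnit (2 : ℤ_[2]) := by
  have hp : Prime (2 : ℤ_[2]) := by simpa using PadicInt.prime_p (p := 2)
  exact hp.not_isUnit

theorem existsUnique_isRoot : ∃! x : ℤ_[2], (charPoly ℤ_[2]).IsRoot x := by
  have h64 : ‖(64 : ℤ_[2])‖ = 1 / 64 := by
    rw [show (64 : ℤ_[2]) = ((2 : ℕ) : ℤ_[2]) ^ 6 by norm_num, PadicInt.norm_p_pow]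
    norm_num
  have h42 : ‖(42 : ℤ_[2])‖ = 1 / 2 := by
    have h2 := PadicInt.norm_p (p := 2)
    have h21 : ‖((21 : ℕ) : ℤ_[2])‖ = 1 := PadicInt.norm_natCast_eq_one_iff.2 (by decide)
    rw [show (42 : ℤ_[2]) = ((2 : ℕ) : ℤ_[2]) * ((21 : ℕ) : ℤ_[2]) by norm_num, norm_mul, h2, h21]
    norm_num
  have e1 : aeval (2 : ℤ_[2]) (charPoly ℤ_[2]) = -64 := by
    simp [charPoly]
    norm_num
  have e2 : aeval (2 : ℤ_[2]) (derivative (charPoly ℤ_[2])) = -42 := by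
    simp [charPoly]
    norm_num
  -- Hensel applies at 2 since `P(2) = -64`, `P'(2) = -42` and `1/64 < (1/2)^2`.
  obtain ⟨z, hz, -⟩ := hensels_lemma (F := charPoly ℤ_[2]) (a := (2 : ℤ_[2])) (by
    rw [e1, e2, norm_neg, norm_neg, h64, h42]
    norm_num)
  have hz' : (charPoly ℤ_[2]).IsRoot z := by simpa [IsRoot] using hz
  refine ⟨z, hz', fun y hy => ?_⟩
  obtain ⟨v, rfl⟩ := two_dvd_of_isRoot hz'
  obtain ⟨w, rfl⟩ := two_dvd_of_isRoot hy
  rw [charPoly_isRoot_iff] at hy hz'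
  by_contra hne
  -- Both roots are even, so the difference quotient of `P` is twice an odd element and cannot
  -- vanish.
  have h0 : (2 * w - 2 * v) *
      (2 * (2 * (w ^ 2 + w * v + v ^ 2) - 12 * (w + v) - 3)) = 0 := by
    linear_combination hy - hz'
  rcases mul_eq_zero.1 h0 with h1 | h1
  · exact hne (sub_eq_zero.1 h1)
  · have h2 := (mul_eq_zero.1 h1).resolve_left two_ne_zero
    exact not_isUnit_two (IsUnit.of_mul_eq_one
      (w ^ 2 + w * v + v ^ 2 - 6 * (w + v) - 1) (by linear_combination h2))

/-- The cubic in `t` reads `t(2t² - 6t - 21) = 16`, whose second factor is a unit for integral `t`.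
-/
theorem exists_emb_eq_of_isRoot {x : ℤ_[2]} (hx : (charPoly ℤ_[2]).IsRoot x) :
    ∃ t : ℂ_[2], emb x = 2 + 2 * t ∧ ‖t‖ ≤ 1 / 16 ∧ t ∈ Set.range (algebraMap ℚ_[2] ℂ_[2]) ∧
      2 * t ^ 3 - 6 * t ^ 2 - 21 * t - 16 = 0 := by
  obtain ⟨v, rfl⟩ := two_dvd_of_isRoot hx
  rw [charPoly_isRoot_iff] at hx
  have hrel := congrArg embHom hx
  simp only [map_sub, map_mul, map_pow, map_ofNat, map_zero] at hrel
  have hrel' : 2 * embHom (v - 1) ^ 3 - 6 * embHom (v - 1) ^ 2 - 21 * embHom (v - 1) - 16 = 0 := by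
    rw [map_sub, map_one]
    have h4 : (4 : ℂ_[2]) ≠ 0 := by norm_num
    refine (mul_eq_zero.1 ?_).resolve_left h4
    linear_combination hrel
  refine ⟨embHom (v - 1), ?_, ?_, ⟨_, rfl⟩, hrel'⟩
  · rw [← embHom_apply, map_mul, map_sub, map_ofNat, map_one]
    ring
  · have hle : ‖embHom (v - 1)‖ ≤ 1 := (norm_emb _).trans_le (PadicInt.norm_le_one _)
    generalize embHom (v - 1) = t at *
    have h1 : ‖2 * t ^ 2 - 6 * t - 21‖ = (1 / 2) ^ 0 :=
      norm_eq_of_eq_two_pow_mul hle 0 1 (-11) (-3) 1 0 (by decide) (by push_cast; ring)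
    have h2 : ‖t * (2 * t ^ 2 - 6 * t - 21)‖ = 1 / 16 := by
      rw [show t * (2 * t ^ 2 - 6 * t - 21) = 2 ^ 4 by linear_combination hrel', norm_pow,
        norm_two]
      norm_num
    rw [norm_mul, h1, pow_zero, mul_one] at h2
    exact h2.le

theorem exists_isRootTriple_of_charPoly_eq {x : ℤ_[2]} {b₂ b₃ : ℂ_[2]}
    (hx : charPoly ℂ_[2] = (X - C (emb x)) * (X - C b₂) * (X - C b₃)) :
    ∃ t, emb x = 2 + 2 * t ∧ IsRootTriple t b₂ b₃ := by
  have hroot : (charPoly ℤ_[2]).IsRoot x := by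
    rw [charPoly_isRoot_iff]
    have h0 : (charPoly ℂ_[2]).IsRoot (emb x) := by simp [hx]
    rw [charPoly_isRoot_iff] at h0
    refine isometry_emb.injective ?_
    rw [← embHom_apply, ← embHom_apply]
    simp only [map_sub, map_mul, map_pow, map_ofNat, map_zero]
    exact h0
  obtain ⟨t, ht, hn, hr, hrel⟩ := exists_emb_eq_of_isRoot hroot
  rw [ht] at hx
  -- The values at `0, 1, -1` recover the coefficients, hence the sum and product of `b₂, b₃`.
  have e0 := congrArg (eval 0) hx
  have e1 := congrArg (eval 1) hx
  have e2 := congrArg (eval (-1)) hx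
  simp [charPoly] at e0 e1 e2
  have hs : b₂ + b₃ = 10 - 2 * t := by
    linear_combination (e1 + e2) / 2 - e0
  refine ⟨t, ht, hn, hr, hs, ?_, hrel⟩
  linear_combination (e2 - e1) / 2 - (2 + 2 * t) * hs

theorem exists_isRootTriple : ∃ t b₂ b₃, IsRootTriple t b₂ b₃ := by
  obtain ⟨x, hx, -⟩ := existsUnique_isRoot
  obtain ⟨t, -, hn, hr, hrel⟩ := exists_emb_eq_of_isRoot hx
  obtain ⟨s, hs⟩ := IsAlgClosed.exists_pow_nat_eq
    ((10 - 2 * t) ^ 2 - 4 * (-26 - 16 * t + 4 * t ^ 2)) two_pos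
  refine ⟨t, (10 - 2 * t + s) / 2, (10 - 2 * t - s) / 2, hn, hr, by ring, ?_, hrel⟩
  linear_combination -hs / 4

theorem IsRootTriple.emb_eq {t b₂ b₃ : ℂ_[2]} (h : IsRootTriple t b₂ b₃) {ζ : ℤ_[2]}
    (hζ : AttractsPeaks ζ) :
    emb ζ = 1 + 4 * (1 / padicLog 2 ((b₃ / b₂) ^ 4)) * padicLog 2 (target t b₂ b₃) := by
  obtain ⟨i, hi⟩ := h.exists_peaks
  have h1 := (isometry_emb.continuous.tendsto ζ).comp (hζ i hi)
  simp only [Function.comp_def, emb_natCast] at h1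
  exact tendsto_nhds_unique h1 (h.tendsto_index hi)

theorem existsUnique_attractsPeaks : ∃! ζ : ℤ_[2], AttractsPeaks ζ := by
  obtain ⟨t, b₂, b₃, h⟩ := exists_isRootTriple
  obtain ⟨i, hi⟩ := h.exists_peaks
  -- The value is a limit of natural numbers, and the isometric image of the complete space `ℤ₂` is
  -- closed.
  obtain ⟨ζ, hζ⟩ : 1 + 4 * (1 / padicLog 2 ((b₃ / b₂) ^ 4)) * padicLog 2 (target t b₂ b₃) ∈
      Set.range emb :=
    isometry_emb.isClosedEmbedding.isClosed_range.mem_of_tendsto (h.tendsto_index hi)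
      (.of_forall fun n => ⟨i n, emb_natCast _⟩)
  refine ⟨ζ, fun j hj => ?_, fun ξ hξ => isometry_emb.injective ((h.emb_eq hξ).trans hζ.symm)⟩
  rw [isometry_emb.isEmbedding.tendsto_nhds_iff, hζ]
  simpa only [Function.comp_def, emb_natCast] using h.tendsto_index hj

end ToySystem

end

theorem theoremp :
    (∃! ζ : ℤ_[2], ToySystem.AttractsPeaks ζ) ∧
    (∃! β₁ : ℤ_[2], (ToySystem.charPoly ℤ_[2]).IsRoot β₁) ∧
    ∀ (β₁ : ℤ_[2]) (β₂ β₃ : ℂ_[2]),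
      ToySystem.charPoly ℂ_[2] = (X - C (ToySystem.emb β₁)) * (X - C β₂) * (X - C β₃) →
      ∀ c₁ c₂ c₃ L : ℂ_[2],
        c₁ = ToySystem.coeff (ToySystem.emb β₁) β₂ β₃ →
        c₂ = ToySystem.coeff β₂ β₃ (ToySystem.emb β₁) →
        c₃ = ToySystem.coeff β₃ (ToySystem.emb β₁) β₂ →
        L = ToySystem.padicLog 2 ((β₃ / β₂) ^ 4) →
        (∀ i : ℕ, (ToySystem.U i : ℂ_[2]) =
          c₁ * ToySystem.emb β₁ ^ i + c₂ * β₂ ^ i + c₃ * β₃ ^ i) ∧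
        β₂ ≠ 0 ∧ β₃ ≠ 0 ∧ c₃ ≠ 0 ∧ L ≠ 0 ∧
        ‖(β₃ / β₂) ^ 4 - 1‖ < 1 ∧
        ‖-(c₂ * β₂) / (c₃ * β₃) - 1‖ < 1 ∧
        ∀ ζ : ℤ_[2], ToySystem.AttractsPeaks ζ →
          ToySystem.emb ζ =
            1 + 4 * (1 / L) * ToySystem.padicLog 2 (-(c₂ * β₂) / (c₃ * β₃)) := by
  refine ⟨ToySystem.existsUnique_attractsPeaks, ToySystem.existsUnique_isRoot, ?_⟩
  rintro β₁ β₂ β₃ hfactor _ _ _ _ rfl rfl rfl rfl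
  obtain ⟨t, ht, h⟩ := ToySystem.exists_isRootTriple_of_charPoly_eq hfactor
  rw [ht]
  refine ⟨h.coeff_sum_eq, h.ne_zero, h.symm.ne_zero, h.coeff_third_ne_zero, h.log_ratio_ne_zero,
    ?_, ?_, fun ζ hζ => h.emb_eq hζ⟩
  · rw [h.norm_ratio_pow_four_sub_one]
    norm_num
  · exact h.norm_target_sub_one.trans_lt (by norm_num)
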